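/- **Setting.** Let $G=(V,E)$ be an undirected graph on $N$ agents (connectedness is not needed), let $n(i)$ be the set of neighbors of $i$, and fix constants $\beta_{ij}\in\mathbb R$ ($j\ne i$), $\delta\in\mathbb R$ and noise variances $c_i>0$. The private signals are $x_i=\theta+\epsilon_i$, where the noises $\epsilon_i\sim N(0,c_i)$ are independent of each other and of the state $\theta\in\mathbb R$, and $\theta$ has the flat (Lebesgue) prior; $x=(x_1,\dots,x_N)^T$. At each stage $t=0,1,2,\dots$ agent $i$ takes an action $a_i(t)=\sigma_{i,t}(h_{i,t})\in\mathbb R$, a measurable function of its history $h_{i,t}=\{x_i,(a_j(u))_{j\in n(i)},\,u<t\}$, and has the payoff $$u_i(a,\theta)=-\tfrac12a_i^2+\sum_{j\ne i}\beta_{ij}a_ia_j+\delta a_i\theta .$$ The posterior (belief) of agent $i$ at time $t$ is the regular conditional distribution of $(\theta,x)$ given $h_{i,t}$ when the profile $\sigma$ is played, and $\mathbf E_{i,t}$ is the expectation under it. A profile of stage-$t$ strategies $(s_i)_{i\in V}$ is a *stage-$t$ equilibrium* (given that $\sigma$ was played at all times $u<t$) if for every $i$ and almost every history $h_{i,t}$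 the expected payoff $\mathbf E_{i,t}[u_i((a,(s_j(h_{j,t}))_{j\ne i}),\theta)]$ is well defined for every $a\in\mathbb R$ and is maximal at $a=s_i(h_{i,t})$. The profile $\sigma$ is a Bayesian Nash equilibrium if $(\sigma_{i,t})_{i\in V}$ is a stage-$t$ equilibrium for every $t$. **Recursion.** Let $e_i$ be the $i$-th standard basis vector of $\mathbb R^N$, $\mathbf 1$ the all-one vector, $\bar e_i=\mathbf 1-e_i$, $c=(c_1,\dots,c_N)^T$, and let $A^{+}$ be the Moore–Penrose inverse of $A$ (so $A^+=A^{-1}$ if $A$ is invertible). Given vectors $v_{i,t}\in\mathbb R^N$, define for all $i$ $$L_{i,0}=\mathbf 1e_i^T,\quad k_{i,0}=e_i,\quad M^i_{xx}(0)=\mathrm{diag}(\bar e_i)\,\mathrm{diag}(c)+c_i\bar e_i\bar e_i^T,\quad M^i_{\theta\theta}(0)=c_i,\quad M^i_{\theta x}(0)=c_i\bar e_i^T,$$ let $H_{i,t}^T$ be the matrix with rows $v_{j,t}^TL_{j,t}$, $j\in n(i)$, and put $$K^i_x(t)=M^i_{xx}(t)H_{i,t}\big(H_{i,t}^TM^i_{xx}(t)H_{i,t}\big)^{+},\qquad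 K^i_\theta(t)=M^i_{\theta x}(t)H_{i,t}\big(H_{i,t}^TM^i_{xx}(t)H_{i,t}\big)^{+},$$ $$L_{i,t+1}=L_{i,t}+K^i_x(t)\big(H_{i,t}^T-H_{i,t}^TL_{i,t}\big),\qquad k_{i,t+1}^T=k_{i,t}^T+K^i_\theta(t)\big(H_{i,t}^T-H_{i,t}^TL_{i,t}\big),$$ $$M^i_{xx}(t+1)=M^i_{xx}(t)-K^i_x(t)H_{i,t}^TM^i_{xx}(t),\qquad M^i_{\theta\theta}(t+1)=M^i_{\theta\theta}(t)-K^i_\theta(t)H_{i,t}^TM^i_{\theta x}(t)^T,$$ $$M^i_{\theta x}(t+1)=M^i_{\theta x}(t)-K^i_\theta(t)H_{i,t}^TM^i_{xx}(t).$$ Let $L_t\in\mathbb R^{N^2\times N^2}$ be the block matrix with diagonal blocks $L_{i,t}^T$ and off-diagonal blocks $-\beta_{ij}L_{i,t}^TL_{j,t}^T$, and stack $v_t=[v_{1,t}^T,\dots,v_{N,t}^T]^T$, $k_t=[k_{1,t}^T,\dots,k_{N,t}^T]^T$. **Theorem.** Suppose that $\sigma$ is a Bayesian Nash equilibrium in linear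 strategies, that is, there are vectors $v_{i,t}\in\mathbb R^N$, independent of the histories, such that $\sigma_{i,t}(h_{i,t})=v_{i,t}^T\mathbf E_{i,t}[x]$ for all $i$, all $t$ and almost every history $h_{i,t}$. Then for every $t$: 1. for every $i$ and almost every realization of $(\theta,x)$, the posterior of agent $i$ on $(\theta,x)$ at the realized history is jointly Gaussian with means $\mathbf E_{i,t}[x]=L_{i,t}x$ and $\mathbf E_{i,t}[\theta]=k_{i,t}^Tx$, covariance matrix $M^i_{xx}(t)$ of $x$, variance $M^i_{\theta\theta}(t)$ of $\theta$ and cross covariance $M^i_{\theta x}(t)$, where $L_{i,t},k_{i,t}$ and the $M^i(t)$ are given by the recursion above; 2. the action coefficients can be computed by solving the linear system $L_tw=\delta k_t$: the vector $v_t$ is a solution, and for every solution $w=[w_1^T,\dots,w_N^T]^T$ the strategies $h_{i,t}\mapsto w_i^T\mathbf E_{i,t}[x]$ form a stage-$t$ equilibrium. -/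

import Mathlib

open MeasureTheory ProbabilityTheory Matrix
open scoped NNReal

namespace QuadraticNetworkGame

/-! ### The Moore-Penrose inverse of a symmetric matrix -/

/-- The Moore-Penrose inverse of a symmetric real matrix: in an orthonormal eigenbasis every
non-zero eigenvalue is inverted and zero eigenvalues are kept (`0⁻¹ = 0` in the functional
calculus). For an invertible symmetric matrix it is the inverse. -/
noncomputable def pinv {m : Type*} [Fintype m] [DecidableEq m] (A : Matrix m m ℝ) :
    Matrix m m ℝ :=
  cfc (fun r : ℝ => r⁻¹) A

/-- The Penrose conditions, which characterize the Moore-Penrose inverse. -/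
theorem pinv_penrose {m : Type*} [Fintype m] [DecidableEq m] (A : Matrix m m ℝ)
    (hA : A.IsSymm) :
    A * pinv A * A = A ∧ pinv A * A * pinv A = pinv A ∧
      (A * pinv A).IsSymm ∧ (pinv A * A).IsSymm := by
  have hsa : IsSelfAdjoint A := by
    rw [isSelfAdjoint_iff, star_eq_conjTranspose, conjTranspose_eq_transpose_of_trivial]
    exact hA
  have hfin : (spectrum ℝ A).Finite := Matrix.finite_real_spectrum
  have hc : ∀ f : ℝ → ℝ, ContinuousOn f (spectrum ℝ A) := fun f => hfin.continuousOn f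
  have hid : cfc (fun r : ℝ => r) A = A := cfc_id' ℝ A
  have h1 : A * pinv A = cfc (fun r : ℝ => r * r⁻¹) A := by
    rw [cfc_mul (fun r : ℝ => r) (fun r : ℝ => r⁻¹) A (hc _) (hc _), hid, pinv]
  have h2 : pinv A * A = cfc (fun r : ℝ => r⁻¹ * r) A := by
    rw [cfc_mul (fun r : ℝ => r⁻¹) (fun r : ℝ => r) A (hc _) (hc _), hid, pinv]
  have hsym : ∀ f : ℝ → ℝ, (cfc f A).IsSymm := by
    intro f
    have h : IsSelfAdjoint (cfc f A) := cfc_predicate f A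
    rw [isSelfAdjoint_iff, star_eq_conjTranspose, conjTranspose_eq_transpose_of_trivial] at h
    exact h
  refine ⟨?_, ?_, h1 ▸ hsym _, h2 ▸ hsym _⟩
  · have h3 : cfc (fun r : ℝ => r * r⁻¹ * r) A = A * pinv A * A := by
      rw [cfc_mul (fun r : ℝ => r * r⁻¹) (fun r : ℝ => r) A (hc _) (hc _), hid, h1]
    rw [← h3]
    have h4 : (fun r : ℝ => r * r⁻¹ * r) = fun r => r := by
      funext r
      by_cases hr : r = 0 <;> simp [hr]
    rw [h4]
    exact hid
  · have h3 : cfc (fun r : ℝ => r⁻¹ * r * r⁻¹) A = pinv A * A * pinv A := by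
      rw [cfc_mul (fun r : ℝ => r⁻¹ * r) (fun r : ℝ => r⁻¹) A (hc _) (hc _), h2]
      rfl
    rw [← h3, pinv]
    congr 1
    funext r
    by_cases hr : r = 0 <;> simp [hr]

section Game

variable {V : Type*} [Fintype V] [DecidableEq V]

/-! ### The repeated game -/

/-- The payoff of agent `i` at the action profile `a` when the state of the world is `θ`:
`-a_i² / 2 + ∑_{j ≠ i} β_ij a_i a_j + δ a_i θ`. -/
noncomputable def payoff (β : V → V → ℝ) (δ : ℝ) (i : V) (a : V → ℝ) (θ : ℝ) : ℝ :=
  -(1 / 2) * a i ^ 2 + ∑ j ∈ Finset.univ.erase i, β i j * a i * a j + δ * a i * θ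

/-- Histories of agent `i` at time `t`: the own signal and the actions of the neighbors at the
times `u < t`. -/
abbrev Hist (G : SimpleGraph V) (t : ℕ) (i : V) : Type _ :=
  ℝ × (Fin t → G.neighborSet i → ℝ)

/-- Profiles of pure strategies: `σ t i` maps the time-`t` histories of agent `i` to actions. -/
abbrev Profile (G : SimpleGraph V) : Type _ :=
  ∀ (t : ℕ) (i : V), Hist G t i → ℝ

/-- The history that agent `i` has observed at time `t` when the private signals are `x` and the
profile `σ` has been played at the times `u < t`. -/
def hist {G : SimpleGraph V} (σ : Profile G) (x : V → ℝ) : (t : ℕ) → (i : V) → Hist G t i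
  | 0, i => (x i, Fin.elim0)
  | t + 1, i =>
      ((hist σ x t i).1,
        Fin.snoc (α := fun _ => G.neighborSet i → ℝ) (hist σ x t i).2
          (fun j => σ t j (hist σ x t j)))

/-- The joint law of the state `θ` and the private signals `x_i = θ + ε_i`, where the noises
`ε_i ~ N(0, c_i)` are independent of each other and of `θ`, and `θ` has the flat (Lebesgue)
prior. It is a σ-finite measure of infinite mass. -/
noncomputable def stateSignalLaw (c : V → ℝ≥0) : Measure (ℝ × (V → ℝ)) :=
  ((volume : Measure ℝ).prod (Measure.pi fun i => gaussianReal 0 (c i))).map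
    (fun p => (p.1, fun i => p.1 + p.2 i))

/-- The law of the time-`t` history of agent `i` under the profile `σ`. -/
noncomputable def histLaw {G : SimpleGraph V} (c : V → ℝ≥0) (σ : Profile G) (t : ℕ) (i : V) :
    Measure (Hist G t i) :=
  (stateSignalLaw c).map (fun ω => hist σ ω.2 t i)

/-- `κ` is (a version of) the belief of agent `i` at time `t` on `(θ, x)`, as a function of the
history: the regular conditional distribution of `(θ, x)` given the history that is
generated by the profile `σ`. -/
structure IsPosterior {G : SimpleGraph V} (c : V → ℝ≥0) (σ : Profile G) (t : ℕ) (i : V)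
    (κ : Kernel (Hist G t i) (ℝ × (V → ℝ))) : Prop where
  isMarkov : IsMarkovKernel κ
  disintegrates :
    (stateSignalLaw c).map (fun ω => (hist σ ω.2 t i, ω)) = (histLaw c σ t i) ⊗ₘ κ

/-- The linear strategy `h ↦ wᵀ E_{i,t}[x]`, where the expectation is taken with respect to the
belief at the history `h`. -/
noncomputable def linearStrategy {G : SimpleGraph V} {t : ℕ} {i : V}
    (κ : Kernel (Hist G t i) (ℝ × (V → ℝ))) (w : V → ℝ) (h : Hist G t i) : ℝ :=
  ∑ j, w j * ∫ ω, ω.2 j ∂(κ h)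

/-- The strategies `s` at stage `t` are mutual best responses when `σ` has been played at the
times `u < t` and `κ` are the resulting beliefs: at almost every history `h` of agent `i`, the
expected payoff of `i` given `h`, when the others play `s`, is well defined for each own
action `a`, and is maximal at `a = s i h`. -/
def IsStageEquilibrium {G : SimpleGraph V} (c : V → ℝ≥0) (β : V → V → ℝ) (δ : ℝ)
    (σ : Profile G) (t : ℕ) (κ : ∀ i : V, Kernel (Hist G t i) (ℝ × (V → ℝ)))
    (s : ∀ i : V, Hist G t i → ℝ) : Prop :=
  ∀ i : V, ∀ᵐ h ∂(histLaw c σ t i),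
    (∀ a : ℝ, Integrable
      (fun ω => payoff β δ i (Function.update (fun j => s j (hist σ ω.2 t j)) i a) ω.1)
      (κ i h)) ∧
    IsMaxOn
      (fun a : ℝ =>
        ∫ ω, payoff β δ i (Function.update (fun j => s j (hist σ ω.2 t j)) i a) ω.1 ∂(κ i h))
      Set.univ (s i h)

/-- `σ` is a (myopic) Bayesian Nash equilibrium of the repeated game with beliefs `κ`. -/
def IsBayesNash {G : SimpleGraph V} (c : V → ℝ≥0) (β : V → V → ℝ) (δ : ℝ) (σ : Profile G)
    (κ : ∀ (t : ℕ) (i : V), Kernel (Hist G t i) (ℝ × (V → ℝ))) : Prop :=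
  ∀ t : ℕ, IsStageEquilibrium c β δ σ t (κ t) (σ t)

/-! ### The sequential LMMSE recursion -/

/-- The quantities of one agent that are propagated: the estimation weights `L` (for `x`) and `k`
(for `θ`), and the covariances `M_xx`, `M_θθ` and `M_θx`. -/
structure Coeffs (V : Type*) where
  L : Matrix V V ℝ
  k : V → ℝ
  Mxx : Matrix V V ℝ
  Mθθ : ℝ
  Mθx : V → ℝ

/-- The all-one vector with the `i`-th component nulled. -/
def ebar (i : V) : V → ℝ := 1 - Pi.single i 1

/-- The initial values of agent `i`. -/
def initCoeffs (c : V → ℝ≥0) (i : V) : Coeffs V where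
  L := vecMulVec 1 (Pi.single i 1)
  k := Pi.single i 1
  Mxx := diagonal (ebar i) * diagonal (fun j => (c j : ℝ)) +
    (c i : ℝ) • vecMulVec (ebar i) (ebar i)
  Mθθ := c i
  Mθx := (c i : ℝ) • ebar i

/-- The transposed observation matrix `Hᵀ` of agent `i`; its row for the neighbor `j` is
`v_jᵀ L_j`. -/
def obsMatrix (G : SimpleGraph V) (v : V → V → ℝ) (S : V → Coeffs V) (i : V) :
    Matrix (G.neighborSet i) V ℝ :=
  Matrix.of fun j => v j ᵥ* (S j).L

/-- The LMMSE gain `K_x = M_xx H (Hᵀ M_xx H)⁺`, where `Ht` stands for `Hᵀ`. -/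
noncomputable def gainX {m : Type*} [Fintype m] [DecidableEq m] (S : Coeffs V)
    (Ht : Matrix m V ℝ) : Matrix V m ℝ :=
  S.Mxx * Htᵀ * pinv (Ht * S.Mxx * Htᵀ)

/-- The LMMSE gain `K_θ = M_θx H (Hᵀ M_xx H)⁺`, a row vector, where `Ht` stands for `Hᵀ`. -/
noncomputable def gainTheta {m : Type*} [Fintype m] [DecidableEq m] (S : Coeffs V)
    (Ht : Matrix m V ℝ) : m → ℝ :=
  S.Mθx ᵥ* (Htᵀ * pinv (Ht * S.Mxx * Htᵀ))

/-- One step of the recursion for one agent with transposed observation matrix `Ht`. -/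
noncomputable def updateCoeffs {m : Type*} [Fintype m] [DecidableEq m] (S : Coeffs V)
    (Ht : Matrix m V ℝ) : Coeffs V where
  L := S.L + gainX S Ht * (Ht - Ht * S.L)
  k := S.k + gainTheta S Ht ᵥ* (Ht - Ht * S.L)
  Mxx := S.Mxx - gainX S Ht * Ht * S.Mxx
  Mθθ := S.Mθθ - gainTheta S Ht ⬝ᵥ (Ht *ᵥ S.Mθx)
  Mθx := S.Mθx - gainTheta S Ht ᵥ* (Ht * S.Mxx)

/-- The values at time `t` of all agents, computed from the action coefficients `v u`, `u < t`. -/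
noncomputable def coeffs (G : SimpleGraph V) [DecidableRel G.Adj] (c : V → ℝ≥0)
    (v : ℕ → V → V → ℝ) : ℕ → V → Coeffs V
  | 0 => fun i => initCoeffs c i
  | t + 1 => fun i =>
      updateCoeffs (coeffs G c v t i) (obsMatrix G (v t) (coeffs G c v t) i)

/-- The block matrix with diagonal blocks `L_iᵀ` and off-diagonal blocks `-β_ij L_iᵀ L_jᵀ`; the
first components of an index name the block. -/
def blockMatrix (β : V → V → ℝ) (S : V → Coeffs V) : Matrix (V × V) (V × V) ℝ :=
  Matrix.of fun p q =>
    if p.1 = q.1 then (S p.1).Lᵀ p.2 q.2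
    else (-(β p.1 q.1) • ((S p.1).Lᵀ * (S q.1).Lᵀ)) p.2 q.2

/-- The linear system `L_t w = δ k_t` for the stacked action coefficients `w`. -/
def SolvesSystem (β : V → V → ℝ) (δ : ℝ) (S : V → Coeffs V) (w : V → V → ℝ) : Prop :=
  blockMatrix β S *ᵥ (fun p => w p.1 p.2) = δ • (fun p : V × V => (S p.1).k p.2)

/-- The law `μ` of `(θ, x)` is jointly Gaussian with means `E[x] = L y` and `E[θ] = kᵀ y` and with
covariances `M_xx`, `M_θθ`, `M_θx`; here `y` are the realized signals. -/
structure IsGaussianBelief (μ : Measure (ℝ × (V → ℝ))) (S : Coeffs V) (y : V → ℝ) : Prop where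
  gaussian : IsGaussian μ
  mean_x : ∀ j, ∫ ω, ω.2 j ∂μ = (S.L *ᵥ y) j
  mean_θ : ∫ ω, ω.1 ∂μ = S.k ⬝ᵥ y
  cov_xx : ∀ j l, cov[fun ω => ω.2 j, fun ω => ω.2 l; μ] = S.Mxx j l
  cov_θθ : cov[fun ω => ω.1, fun ω => ω.1; μ] = S.Mθθ
  cov_θx : ∀ j, cov[fun ω => ω.1, fun ω => ω.2 j; μ] = S.Mθx j

end Game

end QuadraticNetworkGame

open QuadraticNetworkGame

/-!
Play in linear strategies is, along almost every realization, a linear function of the signals, so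
the beliefs are those of a linear Gaussian filter and the equilibrium conditions are linear.

*Beliefs.* Fix agent `i`. The flat prior is translation invariant, so in the coordinates `s = x_i`
and `ε` the law of `(θ, x)` is the product of Lebesgue measure and the noise law
(`stateSignalLaw_eq`). If `L 1 = 1` and `kᵀ 1 = 1`, then the estimation errors `x - L x = (1 - L) ε`
and `θ - kᵀ x = -kᵀ ε` are functions of the noises. The recursion keeps them uncorrelated with every
observed functional that does not depend on `s` (`IsLMMSE`, `IsLMMSE.updateCoeffs`), hence
independent of the whole history (`map_obs_residual_eq_prod`). The law of the errors, shifted by the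
estimates, is therefore a conditional law of `(θ, x)` given the history, and uniqueness of
disintegrations identifies it with the given belief (`exists_posterior_eq_map_residual`). An
induction on time shows that the histories are almost surely linear in the signals
(`ae_hist_eq_linHist`).

*Equilibrium.* When the other agents play linear functions of the signals, the expected payoff is a
concave quadratic function of the own action, so equilibrium means that each action is equal to the
affine best response (`isStageEquilibrium_iff`). In terms of the estimates both sides are linear
functionals of the signals; those agree almost everywhere if and only if their coefficients agree
(`eq_zero_of_ae_dotProduct_eq_zero`), and the equations for the coefficients are the linear system
(`solvesSystem_iff`).
-/

namespace QuadraticNetworkGame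

/-! ### The estimation recursion -/

/-- For `C = diagonal d` positive semidefinite and `P = F C Fᵀ`, the kernel of `P` is contained in
that of `C Fᵀ`, so the projection `P⁺ P` onto the row space of `P` fixes `C Fᵀ`. This is where the
gain with the Moore-Penrose inverse works for a singular `P`. -/
theorem diagonal_mul_transpose_mul_pinv_mul {m n : Type*} [Fintype m] [DecidableEq m]
    [Fintype n] [DecidableEq n] (d : n → ℝ) (hd : ∀ j, 0 ≤ d j) (F : Matrix m n ℝ) :
    diagonal d * Fᵀ * pinv (F * diagonal d * Fᵀ) * (F * diagonal d * Fᵀ) = diagonal d * Fᵀ := by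
  set P := F * diagonal d * Fᵀ with hP
  have hPs : P.IsSymm := by
    rw [Matrix.IsSymm, hP]
    simp [Matrix.transpose_mul, Matrix.mul_assoc]
  obtain ⟨h1, -, -, -⟩ := pinv_penrose P hPs
  set D := diagonal (fun j => √(d j)) with hD
  have hDD : D * D = diagonal d := by
    rw [hD, diagonal_mul_diagonal]
    congr 1
    funext j
    exact Real.mul_self_sqrt (hd j)
  have hDt : Dᵀ = D := diagonal_transpose _
  set Q := 1 - pinv P * P with hQ
  have hPQ : P * Q = 0 := by
    rw [hQ, Matrix.mul_sub, Matrix.mul_one, ← Matrix.mul_assoc, h1, sub_self]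
  have h0 : (D * Fᵀ * Q)ᵀ * (D * Fᵀ * Q) = 0 := by
    have : (D * Fᵀ * Q)ᵀ * (D * Fᵀ * Q) = Qᵀ * (F * (D * D) * Fᵀ * Q) := by
      simp only [Matrix.transpose_mul, Matrix.transpose_transpose, hDt, Matrix.mul_assoc]
    rw [this, hDD, ← hP, hPQ, Matrix.mul_zero]
  have h2 : D * Fᵀ * Q = 0 := by
    rw [← conjTranspose_eq_transpose_of_trivial] at h0
    exact conjTranspose_mul_self_eq_zero.1 h0
  have h3 : diagonal d * Fᵀ * Q = 0 := by
    rw [← hDD, Matrix.mul_assoc, Matrix.mul_assoc, ← Matrix.mul_assoc D Fᵀ, h2, Matrix.mul_zero]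
  rw [hQ, Matrix.mul_sub, Matrix.mul_one, sub_eq_zero] at h3
  rw [Matrix.mul_assoc _ (pinv P), ← h3]

variable {V : Type*} [Fintype V] [DecidableEq V]

/-- `S` holds the best linear estimates, and the covariances of their errors, given the linear
functionals of the signals in `W`. The estimates are unbiased for every `θ`, they are built from
functionals in `W`, and their errors `(1 - L) ε` and `-kᵀ ε` are uncorrelated with the functionals
in `W` that do not depend on `θ`, that is, whose coefficients sum to zero. -/
structure IsLMMSE (c : V → ℝ≥0) (W : Submodule ℝ (V → ℝ)) (S : Coeffs V) : Prop where
  L_one : S.L *ᵥ 1 = 1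
  k_one : S.k ⬝ᵥ 1 = 1
  L_mem : ∀ z : V → ℝ, z ᵥ* S.L ∈ W
  k_mem : S.k ∈ W
  orth_L : ∀ a ∈ W, a ⬝ᵥ 1 = 0 → (1 - S.L) *ᵥ (diagonal (fun j => (c j : ℝ)) *ᵥ a) = 0
  orth_k : ∀ a ∈ W, a ⬝ᵥ 1 = 0 → S.k ⬝ᵥ (diagonal (fun j => (c j : ℝ)) *ᵥ a) = 0
  Mxx_eq : S.Mxx = (1 - S.L) * diagonal (fun j => (c j : ℝ)) * (1 - S.L)ᵀ
  Mθx_eq : S.Mθx = -(S.k ᵥ* (diagonal (fun j => (c j : ℝ)) * (1 - S.L)ᵀ))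
  Mθθ_eq : S.Mθθ = S.k ⬝ᵥ (diagonal (fun j => (c j : ℝ)) *ᵥ S.k)

theorem isLMMSE_initCoeffs (c : V → ℝ≥0) (i : V) :
    IsLMMSE c (Submodule.span ℝ {Pi.single i 1}) (initCoeffs c i) := by
  have hspan : ∀ a ∈ Submodule.span ℝ {(Pi.single i 1 : V → ℝ)}, a ⬝ᵥ 1 = 0 → a = 0 := by
    intro a ha h
    obtain ⟨r, rfl⟩ := Submodule.mem_span_singleton.1 ha
    have : r = 0 := by simpa using h
    simp [this]
  refine ⟨?_, ?_, ?_, ?_, ?_, ?_, ?_, ?_, ?_⟩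
  · ext j; simp [initCoeffs, vecMulVec, mulVec, dotProduct]
  · simp [initCoeffs]
  · intro z
    simp only [initCoeffs, vecMul_vecMulVec]
    exact Submodule.smul_mem _ _ (Submodule.subset_span rfl)
  · exact Submodule.subset_span rfl
  · intro a ha h; simp [hspan a ha h]
  · intro a ha h; simp [hspan a ha h]
  · ext j l
    simp only [initCoeffs, ebar, Matrix.mul_apply, Matrix.add_apply, Matrix.smul_apply,
      vecMulVec_apply, diagonal_apply, transpose_apply, Matrix.sub_apply, Matrix.one_apply,
      Pi.sub_apply, Pi.one_apply, Pi.single_apply, smul_eq_mul]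
    by_cases hj : j = i <;> by_cases hl : l = i <;> by_cases hjl : j = l <;>
      simp_all [Finset.sum_ite_eq, sub_mul, mul_sub, Finset.sum_sub_distrib, add_comm]
  · ext l
    simp only [initCoeffs, ebar, vecMul, dotProduct, Matrix.mul_apply, diagonal_apply,
      transpose_apply, Matrix.sub_apply, Matrix.one_apply, vecMulVec_apply,
      Pi.sub_apply, Pi.one_apply, Pi.single_apply, smul_eq_mul, Pi.smul_apply, Pi.neg_apply]
    by_cases hl : l = i <;> simp_all
  · simp [initCoeffs]

/-- The recursion step: after observing `Ht x` the errors are multiplied by `T = 1 - C Fᵀ P⁺ F`,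
where `F = Ht (1 - L)` gives the innovation and `P = F C Fᵀ` its covariance. As `T C Fᵀ = 0`, the
new errors are uncorrelated with the innovation, and `T C Tᵀ = T C` gives the new covariances. -/
theorem IsLMMSE.updateCoeffs {m : Type*} [Fintype m] [DecidableEq m] {c : V → ℝ≥0}
    {W : Submodule ℝ (V → ℝ)} {S : Coeffs V} (h : IsLMMSE c W S) (Ht : Matrix m V ℝ) :
    IsLMMSE c (W ⊔ Submodule.span ℝ (Set.range Ht)) (updateCoeffs S Ht) := by
  set C := diagonal (fun j => (c j : ℝ)) with hC
  set F := Ht * (1 - S.L) with hF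
  set R := pinv (F * C * Fᵀ) with hR
  set T := 1 - C * Fᵀ * R * F with hT
  have hMxx : S.Mxx = (1 - S.L) * C * (1 - S.L)ᵀ := h.Mxx_eq
  have hMθx : S.Mθx = -(S.k ᵥ* (C * (1 - S.L)ᵀ)) := h.Mθx_eq
  have hP : Ht * S.Mxx * Htᵀ = F * C * Fᵀ := by
    rw [hMxx, hF, Matrix.transpose_mul]; simp only [Matrix.mul_assoc]
  have hHF : Ht - Ht * S.L = F := by rw [hF, Matrix.mul_sub, Matrix.mul_one]
  have hF1 : F *ᵥ 1 = 0 := by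
    rw [hF, ← mulVec_mulVec, sub_mulVec, h.L_one]; simp
  have hgx : gainX S Ht = (1 - S.L) * (C * Fᵀ * R) := by
    rw [gainX, hP, ← hR, hMxx, hF, Matrix.transpose_mul]; simp only [Matrix.mul_assoc]
  have hgt : gainTheta S Ht = -(S.k ᵥ* (C * Fᵀ * R)) := by
    rw [gainTheta, hP, ← hR, hMθx, neg_vecMul, vecMul_vecMul, hF, Matrix.transpose_mul]
    simp only [Matrix.mul_assoc]
  have hL : 1 - (QuadraticNetworkGame.updateCoeffs S Ht).L = (1 - S.L) * T := by
    simp only [QuadraticNetworkGame.updateCoeffs, hgx, hHF, hT, Matrix.mul_sub, Matrix.mul_one,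
      Matrix.mul_assoc]
    abel
  have hk : (QuadraticNetworkGame.updateCoeffs S Ht).k = S.k ᵥ* T := by
    simp only [QuadraticNetworkGame.updateCoeffs, hgt, hHF, hT, vecMul_sub, vecMul_one,
      neg_vecMul, vecMul_vecMul]
    rw [sub_eq_add_neg]
  have hTF : T * (C * Fᵀ) = 0 := by
    have := diagonal_mul_transpose_mul_pinv_mul (fun j => (c j : ℝ)) (fun j => (c j).2) F
    rw [← hC, ← hR] at this
    rw [hT, Matrix.sub_mul, Matrix.one_mul, sub_eq_zero]
    simpa only [Matrix.mul_assoc] using this.symm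
  have hTC : T * C * Tᵀ = T * C := by
    have h1 : Tᵀ = 1 - Fᵀ * (C * Fᵀ * R)ᵀ := by
      rw [hT, transpose_sub, transpose_mul, transpose_one]
    rw [h1, Matrix.mul_sub, Matrix.mul_one, ← Matrix.mul_assoc, Matrix.mul_assoc T C Fᵀ, hTF,
      Matrix.zero_mul, sub_zero]
  have hT1 : T *ᵥ 1 = 1 := by
    rw [hT, sub_mulVec, ← mulVec_mulVec, hF1]; simp
  have hmem : ∀ z : m → ℝ, z ᵥ* F ∈ W ⊔ Submodule.span ℝ (Set.range Ht) := by
    intro z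
    rw [← hHF, vecMul_sub, ← vecMul_vecMul]
    refine Submodule.sub_mem _ ?_ (Submodule.mem_sup_left (h.L_mem _))
    rw [vecMul_eq_sum]
    exact Submodule.mem_sup_right (Submodule.sum_mem _ fun l _ =>
      Submodule.smul_mem _ _ (Submodule.subset_span ⟨l, rfl⟩))
  have horth : ∀ a ∈ W ⊔ Submodule.span ℝ (Set.range Ht), a ⬝ᵥ 1 = 0 →
      ∃ w ∈ W, w ⬝ᵥ 1 = 0 ∧ T *ᵥ (C *ᵥ a) = C *ᵥ w := by
    intro a ha ha1
    obtain ⟨w, hw, b, hb, rfl⟩ := Submodule.mem_sup.1 ha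
    obtain ⟨z, rfl⟩ : ∃ z : m → ℝ, z ᵥ* Ht = b := by
      obtain ⟨z, hz⟩ := (Submodule.mem_span_range_iff_exists_fun ℝ).1 hb
      exact ⟨z, by rw [vecMul_eq_sum, ← hz]⟩
    -- A new observation is the innovation plus its prediction, and the prediction lies in `W`.
    have hsplit : w + z ᵥ* Ht = (w + z ᵥ* Ht ᵥ* S.L) + z ᵥ* F := by
      rw [← hHF, vecMul_sub, vecMul_vecMul]; abel
    have hzF : z ᵥ* F ⬝ᵥ 1 = 0 := by rw [← dotProduct_mulVec, hF1, dotProduct_zero]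
    have hw' : w + z ᵥ* Ht ᵥ* S.L ∈ W := Submodule.add_mem _ hw (h.L_mem _)
    rw [hsplit] at ha1 ⊢
    rw [add_dotProduct, hzF, add_zero] at ha1
    refine ⟨_, hw', ha1, ?_⟩
    have hTz : T *ᵥ (C *ᵥ (z ᵥ* F)) = 0 := by
      rw [← mulVec_transpose, mulVec_mulVec, mulVec_mulVec, Matrix.mul_assoc, hTF, zero_mulVec]
    have hFw : F *ᵥ (C *ᵥ (w + z ᵥ* Ht ᵥ* S.L)) = 0 := by
      rw [hF, ← mulVec_mulVec, h.orth_L _ hw' ha1, mulVec_zero]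
    rw [mulVec_add, mulVec_add, hTz, add_zero, hT, sub_mulVec, one_mulVec, ← mulVec_mulVec, hFw,
      mulVec_zero, sub_zero]
  refine ⟨?_, ?_, ?_, ?_, ?_, ?_, ?_, ?_, ?_⟩
  · have : (1 - (QuadraticNetworkGame.updateCoeffs S Ht).L) *ᵥ 1 = 0 := by
      rw [hL, ← mulVec_mulVec, hT1, sub_mulVec, h.L_one]; simp
    rw [sub_mulVec, one_mulVec, sub_eq_zero] at this
    exact this.symm
  · rw [hk, ← dotProduct_mulVec, hT1, h.k_one]
  · intro z
    simp only [QuadraticNetworkGame.updateCoeffs, hHF, vecMul_add, ← vecMul_vecMul]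
    exact Submodule.add_mem _ (Submodule.mem_sup_left (h.L_mem z)) (hmem _)
  · simp only [QuadraticNetworkGame.updateCoeffs, hHF]
    exact Submodule.add_mem _ (Submodule.mem_sup_left h.k_mem) (hmem _)
  · intro a ha ha1
    obtain ⟨w, hw, hw1, he⟩ := horth a ha ha1
    rw [hL, ← mulVec_mulVec, he, h.orth_L w hw hw1]
  · intro a ha ha1
    obtain ⟨w, hw, hw1, he⟩ := horth a ha ha1
    rw [hk, ← dotProduct_mulVec, he, h.orth_k w hw hw1]
  · rw [hL, transpose_mul]
    have : (1 - S.L) * T * C * (Tᵀ * (1 - S.L)ᵀ) = (1 - S.L) * (T * C * Tᵀ) * (1 - S.L)ᵀ := by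
      simp only [Matrix.mul_assoc]
    rw [this, hTC]
    simp only [QuadraticNetworkGame.updateCoeffs, hgx]
    rw [hMxx, hT, hF]
    simp only [Matrix.sub_mul, Matrix.mul_sub, Matrix.one_mul, Matrix.mul_one, Matrix.mul_assoc]
  · rw [hL, hk, transpose_mul, vecMul_vecMul]
    have : T * (C * (Tᵀ * (1 - S.L)ᵀ)) = (T * C * Tᵀ) * (1 - S.L)ᵀ := by
      simp only [Matrix.mul_assoc]
    rw [this, hTC]
    simp only [QuadraticNetworkGame.updateCoeffs, hgt]
    rw [hMxx, hMθx, neg_vecMul, vecMul_vecMul, sub_neg_eq_add, neg_add_eq_sub,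
      ← neg_sub, ← vecMul_sub, hT, hF]
    simp only [Matrix.sub_mul, Matrix.one_mul, Matrix.mul_assoc]
  · have h1 : S.k ᵥ* T ⬝ᵥ C *ᵥ (S.k ᵥ* T) = S.k ⬝ᵥ ((T * C * Tᵀ) *ᵥ S.k) := by
      rw [← mulVec_mulVec, ← mulVec_mulVec, dotProduct_mulVec S.k T, mulVec_transpose]
    have h2 : Ht *ᵥ S.Mθx = -((F * C) *ᵥ S.k) := by
      rw [hMθx, ← mulVec_transpose, transpose_mul, transpose_transpose, mulVec_neg, mulVec_mulVec,
        hC, diagonal_transpose, hF, Matrix.mul_assoc]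
    rw [hk, h1, hTC]
    simp only [QuadraticNetworkGame.updateCoeffs, hgt]
    rw [h2, h.Mθθ_eq, neg_dotProduct_neg, ← dotProduct_mulVec, mulVec_mulVec, ← dotProduct_sub,
      ← sub_mulVec, hT, Matrix.sub_mul, Matrix.one_mul]
    simp only [Matrix.mul_assoc]
    rfl

/-! ### Uniqueness of disintegrations -/

/-- Uniqueness of the disintegration over a σ-finite measure, from the case of finite measures. The
σ-finiteness is given by a cover with sets of finite measure. -/
theorem ae_eq_of_compProd_eq_of_cover {α β : Type*} [MeasurableSpace α] [MeasurableSpace β]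
    [MeasurableSpace.CountableOrCountablyGenerated α β] {μ : Measure α} [SFinite μ]
    {κ η : Kernel α β} [IsFiniteKernel κ] [IsFiniteKernel η] (B : ℕ → Set α)
    (hB : ∀ n, MeasurableSet (B n)) (hfin : ∀ n, μ (B n) ≠ ⊤) (hU : ⋃ n, B n = Set.univ)
    (h : μ ⊗ₘ κ = μ ⊗ₘ η) : κ =ᵐ[μ] η := by
  have key : ∀ n, κ =ᵐ[μ.restrict (B n)] η := by
    intro n
    have : IsFiniteMeasure (μ.restrict (B n)) := ⟨by simpa using (hfin n).lt_top⟩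
    refine Kernel.ae_eq_of_compProd_eq ?_
    refine Measure.ext_of_lintegral _ fun f hf => ?_
    have h1 : ∀ ξ : Kernel α β, IsFiniteKernel ξ →
        ∫⁻ p, f p ∂((μ.restrict (B n)) ⊗ₘ ξ) =
          ∫⁻ p, ((B n) ×ˢ Set.univ).indicator f p ∂(μ ⊗ₘ ξ) := by
      intro ξ _
      rw [Measure.lintegral_compProd hf,
        Measure.lintegral_compProd (hf.indicator ((hB n).prod .univ)), ← lintegral_indicator (hB n)]
      congr 1
      funext a
      by_cases ha : a ∈ B n <;> simp [Set.indicator, ha]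
    rw [h1 κ inferInstance, h1 η inferInstance, h]
  have := (ae_restrict_iUnion_iff (μ := μ) B (fun a => κ a = η a)).2 key
  rwa [hU, Measure.restrict_univ] at this

/-- If `(a, e)` has law `μ ⊗ ν`, then the conditional law of `e + m a` given `a` is the shift of `ν`
by `m a`. -/
theorem map_prod_add_eq_compProd {α E : Type*} [MeasurableSpace α] [MeasurableSpace E] [Add E]
    [MeasurableAdd₂ E] (μ : Measure α) [SFinite μ] (ν : Measure E) [IsProbabilityMeasure ν]
    {m : α → E} (hm : Measurable m) :
    ∃ η : Kernel α E, IsMarkovKernel η ∧ (∀ a, η a = ν.map (fun e => e + m a)) ∧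
      (μ.prod ν).map (fun p => (p.1, p.2 + m p.1)) = μ ⊗ₘ η := by
  have hη : Measurable fun a => ν.map (fun e => e + m a) := by
    refine Measure.measurable_of_measurable_coe _ fun s hs => ?_
    have hmeas : Measurable fun p : α × E => p.2 + m p.1 := by fun_prop
    have : (fun a => (ν.map (fun e => e + m a)) s) =
        fun a => ν (Prod.mk a ⁻¹' ((fun p : α × E => p.2 + m p.1) ⁻¹' s)) := by
      funext a
      rw [Measure.map_apply (by fun_prop) hs]
      rfl
    rw [this]
    exact measurable_measure_prodMk_left (hmeas hs)
  refine ⟨⟨_, hη⟩, ⟨fun a => ?_⟩, fun a => rfl, ?_⟩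
  · exact Measure.isProbabilityMeasure_map (by fun_prop)
  · have : IsMarkovKernel (⟨_, hη⟩ : Kernel α E) :=
      ⟨fun a => Measure.isProbabilityMeasure_map (by fun_prop)⟩
    refine Measure.ext_of_lintegral _ fun f hf => ?_
    rw [lintegral_map hf (by fun_prop), Measure.lintegral_compProd hf,
      lintegral_prod _ (by fun_prop)]
    refine lintegral_congr fun a => ?_
    change _ = ∫⁻ b, f (a, b) ∂(ν.map (fun e => e + m a))
    rw [lintegral_map (by fun_prop) (by fun_prop)]

/-! ### The Gaussian noise -/

/-- The joint law of the noises `ε_i`. -/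
noncomputable def noise (c : V → ℝ≥0) : Measure (V → ℝ) :=
  Measure.pi fun i => gaussianReal 0 (c i)

omit [DecidableEq V] in
theorem iIndepFun_noise (c : V → ℝ≥0) : iIndepFun (fun i (ε : V → ℝ) => ε i) (noise c) :=
  iIndepFun_pi (X := fun _ x => x) fun _ => aemeasurable_id

omit [DecidableEq V] in
theorem map_eval_noise (c : V → ℝ≥0) (i : V) :
    (noise c).map (fun ε => ε i) = gaussianReal 0 (c i) :=
  (measurePreserving_eval (fun i => gaussianReal 0 (c i)) i).map_eq

omit [DecidableEq V] in
instance isGaussian_noise (c : V → ℝ≥0) : IsGaussian (noise c) := by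
  have h := (iIndepFun_noise c).hasGaussianLaw fun i =>
    ⟨by rw [map_eval_noise]; infer_instance⟩
  simpa using h.isGaussian_map

omit [DecidableEq V] in
theorem memLp_eval_noise (c : V → ℝ≥0) (i : V) : MemLp (fun ε : V → ℝ => ε i) 2 (noise c) := by
  exact (HasGaussianLaw.eval (X := fun i (ε : V → ℝ) => ε i)
    (IsGaussian.hasGaussianLaw_id (μ := noise c)) i).memLp_two

omit [DecidableEq V] in
theorem integral_dotProduct_noise (c : V → ℝ≥0) (a : V → ℝ) :
    ∫ ε, a ⬝ᵥ ε ∂(noise c) = 0 := by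
  simp only [dotProduct]
  rw [integral_finsetSum _ fun j _ =>
    ((memLp_eval_noise c j).integrable one_le_two).const_mul _]
  refine Finset.sum_eq_zero fun j _ => ?_
  rw [integral_const_mul]
  have : ∫ ε, ε j ∂(noise c) = ∫ x, x ∂((noise c).map (fun ε => ε j)) := by
    rw [integral_map (measurable_pi_apply j).aemeasurable (by fun_prop)]
  rw [this, map_eval_noise, integral_id_gaussianReal, mul_zero]

theorem covariance_eval_noise (c : V → ℝ≥0) (j l : V) :
    cov[fun ε => ε j, fun ε => ε l; noise c] = if j = l then (c j : ℝ) else 0 := by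
  split_ifs with h
  · subst h
    rw [covariance_self (measurable_pi_apply j).aemeasurable]
    have : Var[fun x => x; (noise c).map (fun ε => ε j)] = Var[fun ε => ε j; noise c] := by
      exact variance_map (X := fun x : ℝ => x) (Y := fun ε : V → ℝ => ε j) aemeasurable_id
        (measurable_pi_apply j).aemeasurable
    rw [← this, map_eval_noise, variance_fun_id_gaussianReal]
  · exact ((iIndepFun_noise c).indepFun h).covariance_eq_zero (memLp_eval_noise c j)
      (memLp_eval_noise c l)

theorem covariance_dotProduct_noise (c : V → ℝ≥0) (a b : V → ℝ) :
    cov[fun ε => a ⬝ᵥ ε, fun ε => b ⬝ᵥ ε; noise c] =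
      a ⬝ᵥ (diagonal (fun j => (c j : ℝ)) *ᵥ b) := by
  simp only [dotProduct]
  rw [covariance_fun_sum_fun_sum (fun j => (memLp_eval_noise c j).const_mul _)
    (fun j => (memLp_eval_noise c j).const_mul _)]
  refine Finset.sum_congr rfl fun j _ => ?_
  simp_rw [covariance_const_mul_left, covariance_const_mul_right, covariance_eval_noise]
  simp [mulVec, dotProduct, diagonal_apply, mul_comm]

/-! ### The law of the state and the signals -/

omit [DecidableEq V] in
/-- Coordinates centered at agent `i`. By translation invariance of the prior, the signal
`s = x_i` has Lebesgue law and is independent of the noises; then `θ = s - ε_i` and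
`x_j = s + ε_j - ε_i`. -/
theorem stateSignalLaw_eq (c : V → ℝ≥0) (i : V) :
    stateSignalLaw c = ((volume : Measure ℝ).prod (noise c)).map
      (fun p => (p.1 - p.2 i, fun j => p.1 + (p.2 j - p.2 i))) := by
  have h : MeasurePreserving (fun p : (V → ℝ) × ℝ => (p.1, p.2 - p.1 i))
      ((noise c).prod volume) ((noise c).prod volume) := by
    refine (MeasurePreserving.id _).skew_product (g := fun (ε : V → ℝ) (x : ℝ) => x - ε i)
      (by unfold Function.uncurry; fun_prop) (Filter.Eventually.of_forall fun ε => ?_)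
    exact (measurePreserving_sub_right volume (ε i)).map_eq
  have h' : (volume : Measure ℝ).prod (noise c) =
      ((volume : Measure ℝ).prod (noise c)).map (fun p => (p.1 - p.2 i, p.2)) := by
    conv_lhs => rw [← Measure.prod_swap, ← h.map_eq, ← Measure.prod_swap]
    rw [Measure.map_map (by fun_prop) (by fun_prop), Measure.map_map (by fun_prop) (by fun_prop)]
    rfl
  rw [stateSignalLaw]
  change ((volume : Measure ℝ).prod (noise c)).map _ = _
  rw [h', Measure.map_map (by fun_prop) (by fun_prop), ← h']
  congr 1
  funext p
  simp only [Function.comp]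
  congr 1
  funext j
  ring

omit [DecidableEq V] in
instance (c : V → ℝ≥0) : SFinite (stateSignalLaw c) := by
  unfold stateSignalLaw; infer_instance

omit [DecidableEq V] in
theorem map_eval_stateSignalLaw (c : V → ℝ≥0) (i : V) :
    (stateSignalLaw c).map (fun ω => ω.2 i) = volume := by
  rw [stateSignalLaw_eq c i, Measure.map_map (by fun_prop) (by fun_prop)]
  have : ((fun ω : ℝ × (V → ℝ) => ω.2 i) ∘ fun p : ℝ × (V → ℝ) =>
      (p.1 - p.2 i, fun j => p.1 + (p.2 j - p.2 i))) = Prod.fst := by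
    funext p; simp
  rw [this, Measure.map_fst_prod]
  simp

/-- The signals are not supported in a hyperplane: for fixed `θ` a linear functional that vanishes
almost surely has variance `∑ c_j a_j² = 0`. -/
theorem eq_zero_of_ae_dotProduct_eq_zero {c : V → ℝ≥0} (hc : ∀ i, 0 < c i) {a : V → ℝ}
    (h : ∀ᵐ ω ∂(stateSignalLaw c), a ⬝ᵥ ω.2 = 0) : a = 0 := by
  rw [stateSignalLaw] at h
  have h1 := ae_of_ae_map (by fun_prop) h
  obtain ⟨θ, hθ⟩ := (Measure.ae_ae_of_ae_prod h1).exists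
  change ∀ᵐ ε ∂(noise c), _ at hθ
  have h2 : (fun ε => a ⬝ᵥ ε) =ᵐ[noise c] fun _ => -(θ * (a ⬝ᵥ 1)) := by
    filter_upwards [hθ] with ε hε
    have : (fun i => θ + ε i) = θ • (1 : V → ℝ) + ε := by funext i; simp
    simp only [this, dotProduct_add, dotProduct_smul, smul_eq_mul] at hε
    linarith
  have h3 : a ⬝ᵥ (diagonal (fun j => (c j : ℝ)) *ᵥ a) = 0 := by
    have hm : Measurable fun ε : V → ℝ => a ⬝ᵥ ε := by unfold dotProduct; fun_prop
    rw [← covariance_dotProduct_noise, covariance_self hm.aemeasurable, variance_congr h2]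
    simp [variance, evariance]
  simp only [mulVec_diagonal, dotProduct] at h3
  have h4 := (Finset.sum_eq_zero_iff_of_nonneg (fun j _ => by
    have := (c j).2
    nlinarith [mul_nonneg this (mul_self_nonneg (a j))])).1 h3
  funext j
  have := h4 j (Finset.mem_univ j)
  have hj : (0 : ℝ) < c j := hc j
  simpa [hj.ne'] using this

/-! ### Gaussian beliefs -/

/-- The estimation errors `(θ - kᵀ x, x - L x)` as a function of the noises `ε`. If `kᵀ 1 = 1` and
`L 1 = 1`, then the state cancels and they are equal to `(-kᵀ ε, (1 - L) ε)`. -/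
noncomputable def residual (S : Coeffs V) : (V → ℝ) →L[ℝ] ℝ × (V → ℝ) :=
  LinearMap.toContinuousLinearMap
    { toFun := fun ε => (-(S.k ⬝ᵥ ε), (1 - S.L) *ᵥ ε)
      map_add' := fun ε ε' => by simp [dotProduct_add, mulVec_add, add_comm]
      map_smul' := fun r ε => by simp [mulVec_smul] }

theorem residual_apply (S : Coeffs V) (ε : V → ℝ) :
    residual S ε = (-(S.k ⬝ᵥ ε), (1 - S.L) *ᵥ ε) := rfl

theorem isGaussianBelief_map_residual {c : V → ℝ≥0} {W : Submodule ℝ (V → ℝ)} {S : Coeffs V}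
    (h : IsLMMSE c W S) (y : V → ℝ) :
    IsGaussianBelief (((noise c).map (residual S)).map (fun e => e + (S.k ⬝ᵥ y, S.L *ᵥ y))) S y := by
  set μ := ((noise c).map (residual S)).map (fun e => e + (S.k ⬝ᵥ y, S.L *ᵥ y)) with hμ
  have hG : IsGaussian μ := by rw [hμ]; infer_instance
  have hμ' : μ = (noise c).map (fun ε => residual S ε + (S.k ⬝ᵥ y, S.L *ᵥ y)) := by
    rw [hμ, Measure.map_map (by fun_prop) (by fun_prop)]; rfl
  have hlin : ∀ a : V → ℝ, Integrable (fun ε => a ⬝ᵥ ε) (noise c) := fun a =>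
    integrable_finsetSum _ fun j _ => ((memLp_eval_noise c j).integrable one_le_two).const_mul _
  have hx : ∀ j ε, (residual S ε + (S.k ⬝ᵥ y, S.L *ᵥ y)).2 j = (1 - S.L) j ⬝ᵥ ε + (S.L *ᵥ y) j :=
    fun j ε => rfl
  have hθ : ∀ ε, (residual S ε + (S.k ⬝ᵥ y, S.L *ᵥ y)).1 = (-S.k) ⬝ᵥ ε + S.k ⬝ᵥ y :=
    fun ε => by simp [residual_apply]
  refine ⟨hG, fun j => ?_, ?_, fun j l => ?_, ?_, fun j => ?_⟩
  · rw [hμ', integral_map (by fun_prop) (by fun_prop)]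
    simp_rw [hx]
    rw [integral_add (hlin _) (integrable_const _), integral_dotProduct_noise]
    simp
  · rw [hμ', integral_map (by fun_prop) (by fun_prop)]
    simp_rw [hθ]
    rw [integral_add (hlin _) (integrable_const _), integral_dotProduct_noise]
    simp
  · rw [hμ', covariance_map_fun (by fun_prop) (by fun_prop) (by fun_prop)]
    simp_rw [hx]
    rw [covariance_add_const_left (hlin _), covariance_add_const_right (hlin _),
      covariance_dotProduct_noise, h.Mxx_eq, Matrix.mul_assoc, Matrix.mul_apply]
    rfl
  · rw [hμ', covariance_map_fun (by fun_prop) (by fun_prop) (by fun_prop)]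
    simp_rw [hθ]
    rw [covariance_add_const_left (hlin _), covariance_add_const_right (hlin _),
      covariance_dotProduct_noise, h.Mθθ_eq, mulVec_neg, neg_dotProduct_neg]
  · rw [hμ', covariance_map_fun (by fun_prop) (by fun_prop) (by fun_prop)]
    simp_rw [hθ, hx]
    rw [covariance_add_const_left (hlin _), covariance_add_const_right (hlin _),
      covariance_dotProduct_noise, h.Mθx_eq, neg_dotProduct]
    rfl

/-- Jointly Gaussian variables that are uncorrelated are independent; this applies to the
functionals `a_p` of the noises and the residual. -/
theorem indepFun_dotProduct_residual {c : V → ℝ≥0} {ι : Type*} [Finite ι] (a : ι → V → ℝ)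
    (S : Coeffs V)
    (hL : ∀ p, (1 - S.L) *ᵥ (diagonal (fun j => (c j : ℝ)) *ᵥ a p) = 0)
    (hk : ∀ p, S.k ⬝ᵥ (diagonal (fun j => (c j : ℝ)) *ᵥ a p) = 0) :
    IndepFun (fun ε p => a p ⬝ᵥ ε) (residual S) (noise c) := by
  have := Fintype.ofFinite ι
  let b : Option V → V → ℝ := fun q => q.elim (-S.k) (fun j => (1 - S.L) j)
  let Λ : (V → ℝ) →L[ℝ] (ι → ℝ) × (Option V → ℝ) :=
    LinearMap.toContinuousLinearMap
      { toFun := fun ε => (fun p => a p ⬝ᵥ ε, fun q => b q ⬝ᵥ ε)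
        map_add' := fun ε ε' => by simp only [dotProduct_add]; rfl
        map_smul' := fun r ε => by simp only [dotProduct_smul]; rfl }
  have hg : HasGaussianLaw (fun ε => ((fun p => a p ⬝ᵥ ε), fun q => b q ⬝ᵥ ε)) (noise c) :=
    (IsGaussian.hasGaussianLaw_id (μ := noise c)).map Λ
  have h := HasGaussianLaw.indepFun_of_covariance_eval (X := fun p ε => a p ⬝ᵥ ε)
    (Y := fun q ε => b q ⬝ᵥ ε) hg (by
      intro p q
      rw [covariance_comm, covariance_dotProduct_noise]
      cases q with
      | none => simp [b, hk p]
      | some j => exact congrFun (hL p) j)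
  exact h.comp (φ := id) (ψ := fun y : Option V → ℝ => (y none, fun j => y (some j)))
    measurable_id (by fun_prop) |>.congr (Filter.EventuallyEq.rfl)
      (Filter.Eventually.of_forall fun ε => by simp [residual_apply, b, Function.comp]; rfl)

/-- The estimation errors are independent of the observations `x_i` and `a_pᵀ x`, in the sense that
the joint law is a product, although the law of the observations has infinite mass. -/
theorem map_obs_residual_eq_prod {c : V → ℝ≥0} {ι : Type*} [Finite ι] (i : V) (a : ι → V → ℝ)
    {W : Submodule ℝ (V → ℝ)} {S : Coeffs V} (h : IsLMMSE c W S) (hi : Pi.single i 1 ∈ W)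
    (ha : ∀ p, a p ∈ W) :
    (stateSignalLaw c).map (fun ω => ((ω.2 i, fun p => a p ⬝ᵥ ω.2),
        ω - (S.k ⬝ᵥ ω.2, S.L *ᵥ ω.2))) =
      ((stateSignalLaw c).map (fun ω => (ω.2 i, fun p => a p ⬝ᵥ ω.2))).prod
        ((noise c).map (residual S)) := by
  have := Fintype.ofFinite ι
  have hd : ∀ b : V → ℝ, Measurable fun ε : V → ℝ => b ⬝ᵥ ε := fun b => by
    unfold dotProduct; fun_prop
  have hmv : ∀ A : Matrix V V ℝ, Measurable fun ε : V → ℝ => A *ᵥ ε := fun A =>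
    measurable_pi_lambda _ fun j => hd (A j)
  -- Subtracting from `a p` its multiple of the own signal leaves a functional that annihilates the
  -- all-one vector, hence depends on the noises only.
  let a' : ι → V → ℝ := fun p => a p - (a p ⬝ᵥ 1) • Pi.single i 1
  have ha' : ∀ p, a' p ∈ W := fun p => W.sub_mem (ha p) (W.smul_mem _ hi)
  have ha1 : ∀ p, a' p ⬝ᵥ 1 = 0 := fun p => by simp [a', sub_dotProduct]
  have hind := indepFun_dotProduct_residual (c := c) a' S (fun p => h.orth_L _ (ha' p) (ha1 p))
    (fun p => h.orth_k _ (ha' p) (ha1 p))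
  have hprod := (indepFun_iff_map_prod_eq_prod_map_map
    (measurable_pi_lambda _ fun p => hd (a' p)).aemeasurable (by fun_prop)).1 hind
  let Φ : ℝ × (ι → ℝ) → ℝ × (ι → ℝ) := fun q => (q.1, fun p => q.1 * (a p ⬝ᵥ 1) + q.2 p)
  have hΦ : Measurable Φ := by fun_prop
  have hw : ∀ p : ℝ × (V → ℝ), (fun j => p.1 + (p.2 j - p.2 i)) =
      (p.1 - p.2 i) • (1 : V → ℝ) + p.2 := by
    intro p; funext j; simp; ring
  have hobs : ∀ p : ℝ × (V → ℝ), (p.1 + (p.2 i - p.2 i),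
      fun q => a q ⬝ᵥ (fun j => p.1 + (p.2 j - p.2 i))) = Φ (p.1, fun q => a' q ⬝ᵥ p.2) := by
    intro p
    refine Prod.ext (by simp [Φ]) ?_
    funext q
    simp only [hw, Φ, a', dotProduct_add, dotProduct_smul, sub_dotProduct, smul_dotProduct,
      single_dotProduct, smul_eq_mul]
    ring
  have hres : ∀ p : ℝ × (V → ℝ), ((p.1 - p.2 i, fun j => p.1 + (p.2 j - p.2 i)) : ℝ × (V → ℝ)) -
      (S.k ⬝ᵥ (fun j => p.1 + (p.2 j - p.2 i)), S.L *ᵥ (fun j => p.1 + (p.2 j - p.2 i))) =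
      residual S p.2 := by
    intro p
    simp only [hw, residual_apply, dotProduct_add, dotProduct_smul, mulVec_add, mulVec_smul,
      h.k_one, h.L_one, sub_mulVec, one_mulVec]
    refine Prod.ext ?_ ?_
    · simp
    · simp
  have hmap : Measurable fun p : ℝ × (V → ℝ) =>
      (p.1 - p.2 i, fun j => p.1 + (p.2 j - p.2 i)) := by fun_prop
  have hm1 : Measurable fun ω : ℝ × (V → ℝ) => (ω.2 i, fun p => a p ⬝ᵥ ω.2) :=
    (by fun_prop : Measurable fun ω : ℝ × (V → ℝ) => ω.2 i).prodMk
      (measurable_pi_lambda _ fun p => (hd (a p)).comp measurable_snd)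
  have hm2 : Measurable fun ω : ℝ × (V → ℝ) => ω - (S.k ⬝ᵥ ω.2, S.L *ᵥ ω.2) :=
    measurable_id.sub (((hd _).comp measurable_snd).prodMk ((hmv _).comp measurable_snd))
  have hm3 : Measurable fun ε : V → ℝ => fun q => a' q ⬝ᵥ ε :=
    measurable_pi_lambda _ fun p => hd (a' p)
  have e1 : (stateSignalLaw c).map (fun ω => (ω.2 i, fun p => a p ⬝ᵥ ω.2)) =
      ((volume : Measure ℝ).prod ((noise c).map fun ε q => a' q ⬝ᵥ ε)).map Φ := by
    rw [stateSignalLaw_eq c i, Measure.map_map hm1 hmap]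
    conv_rhs => rw [← Measure.map_id (μ := (volume : Measure ℝ))]
    rw [Measure.map_prod_map _ _ measurable_id hm3, Measure.map_map hΦ (by fun_prop)]
    congr 1
    funext p
    exact hobs p
  rw [e1]
  conv_rhs => rw [← Measure.map_id (μ := (noise c).map (residual S))]
  rw [Measure.map_prod_map _ _ hΦ measurable_id]
  have e2 : ((volume : Measure ℝ).prod ((noise c).map fun ε q => a' q ⬝ᵥ ε)).prod
      ((noise c).map (residual S)) = ((volume : Measure ℝ).prod (noise c)).map
        (fun p => ((p.1, fun q => a' q ⬝ᵥ p.2), residual S p.2)) := by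
    have hassoc := ((measurePreserving_prodAssoc (volume : Measure ℝ)
      ((noise c).map fun ε q => a' q ⬝ᵥ ε) ((noise c).map (residual S))).symm _).map_eq
    rw [← hassoc, ← hprod]
    conv_lhs => rw [← Measure.map_id (μ := (volume : Measure ℝ))]
    rw [Measure.map_prod_map _ _ measurable_id (hm3.prodMk (by fun_prop)),
      Measure.map_map (MeasurableEquiv.measurable _) (by fun_prop)]
    rfl
  rw [e2, stateSignalLaw_eq c i, Measure.map_map (hm1.prodMk hm2) hmap,
    Measure.map_map (hΦ.prodMap measurable_id) (by fun_prop)]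
  congr 1
  funext p
  exact Prod.ext (hobs p) (hres p)

/-! ### Histories as linear observations -/

/-- The history of agent `i` at time `t` when the signals are `x` and every agent `j` plays
`v_{j,u}ᵀ L_{j,u} x` at the times `u < t`: a linear function of `x`. -/
noncomputable def linHist (G : SimpleGraph V) [DecidableRel G.Adj] (c : V → ℝ≥0) (v : ℕ → V → V → ℝ)
    (t : ℕ) (i : V) (x : V → ℝ) : Hist G t i :=
  (x i, fun u j => obsMatrix G (v u) (coeffs G c v u) i j ⬝ᵥ x)

/-- The linear functionals of the signals that agent `i` knows at time `t`: the span of the own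
signal and of the observed actions of the neighbors, each functional given by its coefficients. -/
noncomputable def obsSpan (G : SimpleGraph V) [DecidableRel G.Adj] (c : V → ℝ≥0) (v : ℕ → V → V → ℝ)
    (t : ℕ) (i : V) : Submodule ℝ (V → ℝ) :=
  Submodule.span ℝ ({Pi.single i 1} ∪
    {a | ∃ u < t, ∃ j, a = obsMatrix G (v u) (coeffs G c v u) i j})

theorem obsSpan_succ (G : SimpleGraph V) [DecidableRel G.Adj] (c : V → ℝ≥0)
    (v : ℕ → V → V → ℝ) (t : ℕ) (i : V) :
    obsSpan G c v (t + 1) i = obsSpan G c v t i ⊔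
      Submodule.span ℝ (Set.range (obsMatrix G (v t) (coeffs G c v t) i)) := by
  rw [obsSpan, obsSpan, ← Submodule.span_union, Set.union_assoc]
  congr 2
  ext a
  simp only [Set.mem_ofPred_eq, Set.mem_union, Nat.lt_succ_iff_lt_or_eq]
  constructor
  · rintro ⟨u, hu | rfl, j, rfl⟩
    · exact Or.inl ⟨u, hu, j, rfl⟩
    · exact Or.inr ⟨j, rfl⟩
  · rintro (⟨u, hu, j, rfl⟩ | ⟨j, rfl⟩)
    · exact ⟨u, Or.inl hu, j, rfl⟩
    · exact ⟨t, Or.inr rfl, j, rfl⟩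

theorem isLMMSE_coeffs (G : SimpleGraph V) [DecidableRel G.Adj] (c : V → ℝ≥0)
    (v : ℕ → V → V → ℝ) (t : ℕ) (i : V) :
    IsLMMSE c (obsSpan G c v t i) (coeffs G c v t i) := by
  induction t with
  | zero =>
    have : obsSpan G c v 0 i = Submodule.span ℝ {Pi.single i 1} := by simp [obsSpan]
    rw [this]
    exact isLMMSE_initCoeffs c i
  | succ t ih =>
    rw [obsSpan_succ]
    exact ih.updateCoeffs _

theorem exists_measurable_of_mem_obsSpan {G : SimpleGraph V} [DecidableRel G.Adj] {c : V → ℝ≥0}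
    {v : ℕ → V → V → ℝ} {t : ℕ} {i : V} {a : V → ℝ} (ha : a ∈ obsSpan G c v t i) :
    ∃ φ : Hist G t i → ℝ, Measurable φ ∧ ∀ x, φ (linHist G c v t i x) = a ⬝ᵥ x := by
  refine Submodule.span_induction ?_ ?_ ?_ ?_ ha
  · rintro _ (rfl | ⟨u, hu, j, rfl⟩)
    · exact ⟨Prod.fst, measurable_fst, fun x => by simp [linHist]⟩
    · exact ⟨fun h => h.2 ⟨u, hu⟩ j, by fun_prop, fun x => rfl⟩
  · exact ⟨0, measurable_zero, fun x => by simp⟩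
  · rintro a b - - ⟨φ, hφ, ha⟩ ⟨ψ, hψ, hb⟩
    exact ⟨φ + ψ, hφ.add hψ, fun x => by simp [ha, hb, add_dotProduct]⟩
  · rintro r a - ⟨φ, hφ, ha⟩
    exact ⟨r • φ, hφ.const_smul r, fun x => by simp [ha]⟩

theorem measurable_linHist (G : SimpleGraph V) [DecidableRel G.Adj] (c : V → ℝ≥0)
    (v : ℕ → V → V → ℝ) (t : ℕ) (i : V) : Measurable (linHist G c v t i) := by
  unfold linHist dotProduct
  fun_prop

omit [Fintype V] [DecidableEq V] in
theorem measurable_hist {G : SimpleGraph V} {σ : Profile G} (hσ : ∀ t i, Measurable (σ t i))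
    (t : ℕ) : ∀ i, Measurable fun x => hist σ x t i := by
  induction t with
  | zero => intro i; simp only [hist]; fun_prop
  | succ t ih =>
    intro i
    simp only [hist]
    refine (measurable_fst.comp (ih i)).prodMk (measurable_pi_lambda _ fun u => ?_)
    refine Fin.lastCases ?_ (fun u => ?_) u
    · simp only [Fin.snoc_last]
      exact measurable_pi_lambda _ fun j => (hσ t j).comp (ih j)
    · simp only [Fin.snoc_castSucc]
      exact (measurable_pi_apply u).comp (measurable_snd.comp (ih i))

theorem hist_succ_eq_linHist {G : SimpleGraph V} [DecidableRel G.Adj] {c : V → ℝ≥0}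
    {v : ℕ → V → V → ℝ} {σ : Profile G} {t : ℕ} {i : V} {x : V → ℝ}
    (h : hist σ x t i = linHist G c v t i x)
    (hs : ∀ j, σ t j (hist σ x t j) = (v t j ᵥ* (coeffs G c v t j).L) ⬝ᵥ x) :
    hist σ x (t + 1) i = linHist G c v (t + 1) i x := by
  simp only [hist, h]
  refine Prod.ext rfl ?_
  funext u
  refine Fin.lastCases ?_ (fun u => ?_) u
  · simp only [Fin.snoc_last]
    funext j
    exact hs j
  · simp only [Fin.snoc_castSucc]
    rfl

/-! ### The posterior after linear observations -/

/-- If the history is almost surely linear in the signals, then the belief is the law of the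
residual, shifted by a function `m` of the history that recovers the estimates `(kᵀ x, L x)`. The
reason is that the residual is independent of the history, so that this shifted law disintegrates
the joint law, and that the disintegration is almost everywhere unique. -/
theorem exists_posterior_eq_map_residual {G : SimpleGraph V} [DecidableRel G.Adj] {c : V → ℝ≥0}
    {v : ℕ → V → V → ℝ} {σ : Profile G} {t : ℕ} {i : V}
    {κ : Kernel (Hist G t i) (ℝ × (V → ℝ))} (hκ : IsPosterior c σ t i κ)
    (hlin : ∀ᵐ ω ∂(stateSignalLaw c), hist σ ω.2 t i = linHist G c v t i ω.2) :
    ∃ m : Hist G t i → ℝ × (V → ℝ),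
      (∀ x, m (linHist G c v t i x) =
        ((coeffs G c v t i).k ⬝ᵥ x, (coeffs G c v t i).L *ᵥ x)) ∧
      ∀ᵐ h ∂(histLaw c σ t i),
        κ h = ((noise c).map (residual (coeffs G c v t i))).map (fun e => e + m h) := by
  set S := coeffs G c v t i
  have hM : IsLMMSE c (obsSpan G c v t i) S := isLMMSE_coeffs G c v t i
  obtain ⟨φk, hφk, hk⟩ := exists_measurable_of_mem_obsSpan hM.k_mem
  have hrow : ∀ j, S.L j ∈ obsSpan G c v t i := fun j => by
    have := hM.L_mem (Pi.single j 1)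
    rwa [single_one_vecMul] at this
  choose φL hφL hL using fun j => exists_measurable_of_mem_obsSpan (hrow j)
  let m : Hist G t i → ℝ × (V → ℝ) := fun h => (φk h, fun j => φL j h)
  have hm : Measurable m := hφk.prodMk (measurable_pi_lambda _ hφL)
  have hmx : ∀ x, m (linHist G c v t i x) = (S.k ⬝ᵥ x, S.L *ᵥ x) := fun x =>
    Prod.ext (hk x) (funext fun j => hL j x)
  refine ⟨m, hmx, ?_⟩
  have hlinm : Measurable fun ω : ℝ × (V → ℝ) => linHist G c v t i ω.2 :=
    (measurable_linHist G c v t i).comp measurable_snd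
  have hresm : Measurable fun ω : ℝ × (V → ℝ) => ω - (S.k ⬝ᵥ ω.2, S.L *ᵥ ω.2) := by
    unfold mulVec dotProduct; fun_prop
  have hhist : histLaw c σ t i = (stateSignalLaw c).map (fun ω => linHist G c v t i ω.2) :=
    Measure.map_congr hlin
  have hSF : SFinite (histLaw c σ t i) := by rw [histLaw]; infer_instance
  have := hκ.isMarkov
  obtain ⟨η, hη, hηm, hηd⟩ :=
    map_prod_add_eq_compProd (histLaw c σ t i) ((noise c).map (residual S)) hm
  have hres : (stateSignalLaw c).map
      (fun ω => (linHist G c v t i ω.2, ω - (S.k ⬝ᵥ ω.2, S.L *ᵥ ω.2))) =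
      (histLaw c σ t i).prod ((noise c).map (residual S)) := by
    have h0 := map_obs_residual_eq_prod (c := c) i
      (fun p : Fin t × G.neighborSet i => obsMatrix G (v p.1) (coeffs G c v p.1) i p.2) hM
      (Submodule.subset_span (Or.inl rfl))
      (fun p => Submodule.subset_span (Or.inr ⟨p.1, p.1.2, p.2, rfl⟩))
    let Ψ : ℝ × (Fin t × G.neighborSet i → ℝ) → Hist G t i :=
      fun q => (q.1, fun u j => q.2 (u, j))
    have hΨ : Measurable Ψ := by fun_prop
    have h1 := congrArg (Measure.map (Prod.map Ψ id)) h0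
    rw [← Measure.map_prod_map _ _ hΨ measurable_id, Measure.map_id] at h1
    have hmeas1 : Measurable fun ω : ℝ × (V → ℝ) => (ω.2 i, fun p : Fin t × G.neighborSet i =>
        obsMatrix G (v p.1) (coeffs G c v p.1) i p.2 ⬝ᵥ ω.2) := by
      unfold dotProduct; fun_prop
    rw [Measure.map_map (hΨ.prodMap measurable_id) (hmeas1.prodMk hresm),
      Measure.map_map hΨ hmeas1] at h1
    rw [hhist]
    exact h1
  have hdis : (histLaw c σ t i) ⊗ₘ κ = (histLaw c σ t i) ⊗ₘ η := by
    rw [← hκ.disintegrates, ← hηd, ← hres,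
      Measure.map_map (by fun_prop) (hlinm.prodMk hresm)]
    refine Measure.map_congr ?_
    filter_upwards [hlin] with ω hω
    simp [hω, hmx]
  -- The law of the history has infinite mass, but its first component, the own signal, has
  -- Lebesgue law, so bounding that signal gives sets of finite mass.
  have hae := ae_eq_of_compProd_eq_of_cover
    (fun n : ℕ => {h : Hist G t i | h.1 ∈ Set.Icc (-(n : ℝ)) n})
    (fun n => measurable_fst measurableSet_Icc)
    (fun n => by
      have hfst : (histLaw c σ t i).map Prod.fst = volume := by
        rw [hhist, Measure.map_map measurable_fst hlinm]
        exact map_eval_stateSignalLaw c i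
      have : histLaw c σ t i {h : Hist G t i | h.1 ∈ Set.Icc (-(n : ℝ)) n} =
          volume (Set.Icc (-(n : ℝ)) n) := by
        rw [← hfst, Measure.map_apply measurable_fst measurableSet_Icc]; rfl
      rw [this, Real.volume_Icc]
      exact ENNReal.ofReal_ne_top)
    (by
      refine Set.eq_univ_of_forall fun h => Set.mem_iUnion.2 ?_
      obtain ⟨n, hn⟩ := exists_nat_ge |h.1|
      exact ⟨n, abs_le.1 hn⟩)
    hdis
  filter_upwards [hae] with h hh
  rw [hh, hηm]

theorem ae_isGaussian_posterior {G : SimpleGraph V} [DecidableRel G.Adj] {c : V → ℝ≥0}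
    {v : ℕ → V → V → ℝ} {σ : Profile G} {t : ℕ} {i : V}
    {κ : Kernel (Hist G t i) (ℝ × (V → ℝ))} (hκ : IsPosterior c σ t i κ)
    (hlin : ∀ᵐ ω ∂(stateSignalLaw c), hist σ ω.2 t i = linHist G c v t i ω.2) :
    ∀ᵐ h ∂(histLaw c σ t i), IsGaussian (κ h) := by
  obtain ⟨m, -, hm⟩ := exists_posterior_eq_map_residual hκ hlin
  filter_upwards [hm] with h hh
  rw [hh]
  infer_instance

theorem ae_isGaussianBelief {G : SimpleGraph V} [DecidableRel G.Adj] {c : V → ℝ≥0}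
    {v : ℕ → V → V → ℝ} {σ : Profile G} (hσ : ∀ t i, Measurable (σ t i)) {t : ℕ} {i : V}
    {κ : Kernel (Hist G t i) (ℝ × (V → ℝ))} (hκ : IsPosterior c σ t i κ)
    (hlin : ∀ᵐ ω ∂(stateSignalLaw c), hist σ ω.2 t i = linHist G c v t i ω.2) :
    ∀ᵐ ω ∂(stateSignalLaw c),
      IsGaussianBelief (κ (hist σ ω.2 t i)) (coeffs G c v t i) ω.2 := by
  obtain ⟨m, hmx, hm⟩ := exists_posterior_eq_map_residual hκ hlin
  have hmeas : Measurable fun ω : ℝ × (V → ℝ) => hist σ ω.2 t i :=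
    (measurable_hist hσ t i).comp measurable_snd
  filter_upwards [ae_of_ae_map hmeas.aemeasurable hm, hlin] with ω hω hω'
  rw [hω, hω', hmx]
  exact isGaussianBelief_map_residual (isLMMSE_coeffs G c v t i) ω.2

omit [DecidableEq V] in
theorem linearStrategy_eq_of_isGaussianBelief {G : SimpleGraph V} {t : ℕ} {i : V}
    {κ : Kernel (Hist G t i) (ℝ × (V → ℝ))} {h : Hist G t i} {S : Coeffs V} {x : V → ℝ}
    (hB : IsGaussianBelief (κ h) S x) (w : V → ℝ) :
    linearStrategy κ w h = (w ᵥ* S.L) ⬝ᵥ x := by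
  simp only [linearStrategy, hB.mean_x]
  rw [← dotProduct_mulVec]
  rfl

/-- In linear strategies all histories are almost surely linear in the signals. The induction
alternates with `ae_isGaussianBelief`: linear histories up to `t` make the estimates, hence the
actions, linear at `t`. -/
theorem ae_hist_eq_linHist {G : SimpleGraph V} [DecidableRel G.Adj] {c : V → ℝ≥0}
    {v : ℕ → V → V → ℝ} {σ : Profile G} (hσ : ∀ t i, Measurable (σ t i))
    {κ : ∀ (t : ℕ) (i : V), Kernel (Hist G t i) (ℝ × (V → ℝ))}
    (hκ : ∀ t i, IsPosterior c σ t i (κ t i))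
    (hlin : ∀ t i, ∀ᵐ h ∂(histLaw c σ t i), σ t i h = linearStrategy (κ t i) (v t i) h) (t : ℕ) :
    ∀ i, ∀ᵐ ω ∂(stateSignalLaw c), hist σ ω.2 t i = linHist G c v t i ω.2 := by
  induction t with
  | zero =>
    refine fun i => Filter.Eventually.of_forall fun ω => Prod.ext rfl ?_
    funext u
    exact u.elim0
  | succ t ih =>
    intro i
    have hs : ∀ᵐ ω ∂(stateSignalLaw c), ∀ j,
        σ t j (hist σ ω.2 t j) = (v t j ᵥ* (coeffs G c v t j).L) ⬝ᵥ ω.2 := by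
      refine ae_all_iff.2 fun j => ?_
      have hmeas : Measurable fun ω : ℝ × (V → ℝ) => hist σ ω.2 t j :=
        (measurable_hist hσ t j).comp measurable_snd
      filter_upwards [ae_of_ae_map hmeas.aemeasurable (hlin t j),
        ae_isGaussianBelief hσ (hκ t j) (ih j)] with ω h1 h2
      rw [h1, linearStrategy_eq_of_isGaussianBelief h2]
    filter_upwards [ih i, hs] with ω h1 h2
    exact hist_succ_eq_linHist h1 h2

/-! ### Best responses -/

theorem isMaxOn_quadratic_iff (b s : ℝ) :
    IsMaxOn (fun a : ℝ => -(1 / 2) * a ^ 2 + a * b) Set.univ s ↔ s = b := by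
  rw [isMaxOn_univ_iff]
  constructor
  · intro h
    have := h b
    nlinarith [sq_nonneg (s - b)]
  · rintro rfl a
    nlinarith [sq_nonneg (s - a)]

theorem payoff_update (β : V → V → ℝ) (δ : ℝ) (i : V) (s : V → ℝ) (a θ : ℝ) :
    payoff β δ i (Function.update s i a) θ =
      -(1 / 2) * a ^ 2 + a * (∑ j ∈ Finset.univ.erase i, β i j * s j + δ * θ) := by
  rw [payoff, Function.update_self, mul_add, Finset.mul_sum, add_assoc]
  congr 2
  · refine Finset.sum_congr rfl fun j hj => ?_
    rw [Function.update_of_ne (Finset.ne_of_mem_erase hj)]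
    ring
  · ring

/-- The best response of agent `i` with belief `μ` when every other agent `j` plays the linear
function `b_jᵀ x` of the signals: the maximizer of the expected payoff, which is quadratic in the
own action. -/
noncomputable def bestResponse (β : V → V → ℝ) (δ : ℝ) (i : V) (b : V → V → ℝ)
    (μ : Measure (ℝ × (V → ℝ))) : ℝ :=
  ∑ j ∈ Finset.univ.erase i, β i j * (b j ⬝ᵥ fun l => ∫ ω, ω.2 l ∂μ) + δ * ∫ ω, ω.1 ∂μ

theorem integral_payoff_update {μ : Measure (ℝ × (V → ℝ))} [IsGaussian μ] (β : V → V → ℝ)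
    (δ : ℝ) (i : V) (b : V → V → ℝ) {s : V → ℝ × (V → ℝ) → ℝ}
    (hs : ∀ᵐ ω ∂μ, ∀ j, s j ω = b j ⬝ᵥ ω.2) (a : ℝ) :
    Integrable (fun ω => payoff β δ i (Function.update (fun j => s j ω) i a) ω.1) μ ∧
      ∫ ω, payoff β δ i (Function.update (fun j => s j ω) i a) ω.1 ∂μ =
        -(1 / 2) * a ^ 2 + a * bestResponse β δ i b μ := by
  have hid : Integrable (fun ω : ℝ × (V → ℝ) => ω) μ :=
    (IsGaussian.hasGaussianLaw_id (μ := μ)).integrable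
  have h1 : Integrable (fun ω : ℝ × (V → ℝ) => ω.1) μ := hid.fst
  have h2 : ∀ l, Integrable (fun ω : ℝ × (V → ℝ) => ω.2 l) μ := fun l =>
    (ContinuousLinearMap.proj (R := ℝ) (φ := fun _ : V => ℝ) l).integrable_comp hid.snd
  have h3 : ∀ j, Integrable (fun ω : ℝ × (V → ℝ) => b j ⬝ᵥ ω.2) μ := fun j =>
    integrable_finsetSum _ fun l _ => (h2 l).const_mul _
  have h4 : Integrable (fun ω : ℝ × (V → ℝ) =>
      ∑ j ∈ Finset.univ.erase i, β i j * (b j ⬝ᵥ ω.2)) μ :=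
    integrable_finsetSum _ fun j _ => (h3 j).const_mul _
  have hae : (fun ω => payoff β δ i (Function.update (fun j => s j ω) i a) ω.1) =ᵐ[μ]
      fun ω => -(1 / 2) * a ^ 2 +
        a * (∑ j ∈ Finset.univ.erase i, β i j * (b j ⬝ᵥ ω.2) + δ * ω.1) := by
    filter_upwards [hs] with ω hω
    simp only [payoff_update, hω]
  have h5 : Integrable (fun ω : ℝ × (V → ℝ) =>
      a * (∑ j ∈ Finset.univ.erase i, β i j * (b j ⬝ᵥ ω.2) + δ * ω.1)) μ :=
    (h4.add (h1.const_mul δ)).const_mul a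
  have h6 : ∀ j, ∫ ω, b j ⬝ᵥ ω.2 ∂μ = b j ⬝ᵥ fun l => ∫ ω, ω.2 l ∂μ := fun j => by
    simp only [dotProduct]
    rw [integral_finsetSum _ fun l _ => (h2 l).const_mul _]
    simp only [integral_const_mul]
  refine ⟨((integrable_const _).add h5).congr hae.symm, ?_⟩
  rw [integral_congr_ae hae, integral_add (integrable_const _) h5, integral_const_mul a,
    integral_add h4 (h1.const_mul δ), integral_finsetSum _ fun j _ => (h3 j).const_mul _,
    integral_const_mul, bestResponse]
  simp only [integral_const_mul, integral_const, probReal_univ, one_smul, h6]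

/-- The first-order condition: strategies whose actions are linear in the signals along almost
every play form a stage equilibrium if and only if they are best responses after almost every
history. -/
theorem isStageEquilibrium_iff {G : SimpleGraph V} {c : V → ℝ≥0} (β : V → V → ℝ) (δ : ℝ)
    {σ : Profile G} {t : ℕ} {κ : ∀ i : V, Kernel (Hist G t i) (ℝ × (V → ℝ))}
    (hσ : ∀ t i, Measurable (σ t i)) (hκ : ∀ i, IsPosterior c σ t i (κ i))
    (hG : ∀ i, ∀ᵐ h ∂(histLaw c σ t i), IsGaussian (κ i h)) {s : ∀ i : V, Hist G t i → ℝ}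
    {b : V → V → ℝ}
    (hs : ∀ j, ∀ᵐ ω ∂(stateSignalLaw c), s j (hist σ ω.2 t j) = b j ⬝ᵥ ω.2) :
    IsStageEquilibrium c β δ σ t κ s ↔
      ∀ i, ∀ᵐ h ∂(histLaw c σ t i), s i h = bestResponse β δ i b (κ i h) := by
  refine forall_congr' fun i => ?_
  have := (hκ i).isMarkov
  have hSF : SFinite (histLaw c σ t i) := by rw [histLaw]; infer_instance
  have hmeas : Measurable fun ω : ℝ × (V → ℝ) => (hist σ ω.2 t i, ω) :=
    ((measurable_hist hσ t i).comp measurable_snd).prodMk measurable_id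
  -- An event that is almost sure for `(θ, x)` is almost sure under the belief at almost every
  -- history, as mixing the beliefs over the histories gives back the law of `(θ, x)`.
  have hsnd : Measure.QuasiMeasurePreserving Prod.snd (histLaw c σ t i ⊗ₘ κ i)
      (stateSignalLaw c) := by
    refine ⟨measurable_snd, ?_⟩
    rw [← (hκ i).disintegrates, Measure.map_map measurable_snd hmeas]
    exact (Measure.map_id (μ := stateSignalLaw c)).absolutelyContinuous
  have hae : ∀ᵐ h ∂(histLaw c σ t i), ∀ᵐ ω ∂(κ i h), ∀ j,
      s j (hist σ ω.2 t j) = b j ⬝ᵥ ω.2 :=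
    Measure.ae_ae_of_ae_compProd (hsnd.ae (ae_all_iff.2 hs))
  refine Filter.eventually_congr ?_
  filter_upwards [hG i, hae] with h hh hω
  have hpay := integral_payoff_update (μ := κ i h) β δ i b hω
  simp only [fun a => (hpay a).2]
  rw [isMaxOn_quadratic_iff]
  exact and_iff_right fun a => (hpay a).1

/-! ### The linear system -/

/-- The linear system in block form, as an equation between the coefficients of linear functionals
of the signals: the action of `i` on the left, its best response on the right. -/
theorem solvesSystem_iff (β : V → V → ℝ) (δ : ℝ) (S : V → Coeffs V) (w : V → V → ℝ) :
    SolvesSystem β δ S w ↔ ∀ i, w i ᵥ* (S i).L =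
      ∑ j ∈ Finset.univ.erase i, β i j • (w j ᵥ* (S j).L ᵥ* (S i).L) + δ • (S i).k := by
  have key : ∀ i l, (blockMatrix β S *ᵥ (fun p => w p.1 p.2)) (i, l) =
      (w i ᵥ* (S i).L - ∑ j ∈ Finset.univ.erase i, β i j • (w j ᵥ* (S j).L ᵥ* (S i).L)) l := by
    intro i l
    have hb : ∀ j, ∑ q, blockMatrix β S (i, l) (j, q) * w j q =
        if i = j then (w i ᵥ* (S i).L) l else -(β i j • (w j ᵥ* (S j).L ᵥ* (S i).L)) l := by
      intro j
      split_ifs with hij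
      · subst hij
        simp [blockMatrix, vecMul, dotProduct, mul_comm]
      · have : w j ᵥ* (S j).L ᵥ* (S i).L = ((S i).Lᵀ * (S j).Lᵀ) *ᵥ w j := by
          rw [← transpose_mul, mulVec_transpose, vecMul_vecMul]
        rw [this]
        simp only [blockMatrix, of_apply, if_neg hij, Matrix.smul_apply, smul_eq_mul,
          Pi.smul_apply, mulVec, dotProduct, Finset.mul_sum, ← Finset.sum_neg_distrib]
        refine Finset.sum_congr rfl fun q _ => ?_
        ring
    rw [mulVec, dotProduct, Fintype.sum_prod_type]
    simp only [hb]
    rw [← Finset.add_sum_erase _ _ (Finset.mem_univ i), if_pos rfl, Pi.sub_apply, sub_eq_add_neg,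
      Finset.sum_apply, ← Finset.sum_neg_distrib]
    congr 1
    refine Finset.sum_congr rfl fun j hj => ?_
    rw [if_neg (Finset.ne_of_mem_erase hj).symm]
  constructor
  · intro h i
    funext l
    have := (key i l).symm.trans (congrFun h (i, l))
    simp only [Pi.sub_apply, Pi.smul_apply, smul_eq_mul] at this
    simp only [Pi.add_apply, Pi.smul_apply, smul_eq_mul]
    linarith
  · intro h
    funext ⟨i, l⟩
    rw [key, h i]
    simp

theorem bestResponse_eq_of_isGaussianBelief {μ : Measure (ℝ × (V → ℝ))} {S : Coeffs V}
    {x : V → ℝ} (hB : IsGaussianBelief μ S x) (β : V → V → ℝ) (δ : ℝ) (i : V)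
    (b : V → V → ℝ) :
    bestResponse β δ i b μ =
      (∑ j ∈ Finset.univ.erase i, β i j • (b j ᵥ* S.L) + δ • S.k) ⬝ᵥ x := by
  simp only [bestResponse, hB.mean_x, hB.mean_θ, add_dotProduct, sum_dotProduct, smul_dotProduct,
    smul_eq_mul, ← dotProduct_mulVec]

omit [Fintype V] [DecidableEq V] in
theorem measurable_integral_signal {G : SimpleGraph V} {t : ℕ} {i : V}
    (κ : Kernel (Hist G t i) (ℝ × (V → ℝ))) [IsMarkovKernel κ] (l : V) :
    Measurable fun h => ∫ ω, ω.2 l ∂(κ h) :=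
  (StronglyMeasurable.integral_kernel (κ := κ) (f := fun ω : ℝ × (V → ℝ) => ω.2 l)
    (Measurable.stronglyMeasurable (by fun_prop))).measurable

end QuadraticNetworkGame

open QuadraticNetworkGame
theorem theorem1 {V : Type*} [Fintype V] [DecidableEq V]
    (G : SimpleGraph V) [DecidableRel G.Adj]
    (c : V → ℝ≥0) (hc : ∀ i, 0 < c i) (β : V → V → ℝ) (δ : ℝ)
    (σ : Profile G) (hσ : ∀ t i, Measurable (σ t i))
    (κ : ∀ (t : ℕ) (i : V), Kernel (Hist G t i) (ℝ × (V → ℝ)))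
    (hκ : ∀ t i, IsPosterior c σ t i (κ t i))
    (v : ℕ → V → V → ℝ)
    (hlin : ∀ t i, ∀ᵐ h ∂(histLaw c σ t i), σ t i h = linearStrategy (κ t i) (v t i) h)
    (heq : IsBayesNash c β δ σ κ) :
    ∀ t : ℕ,
      (∀ i : V, ∀ᵐ ω ∂(stateSignalLaw c),
        IsGaussianBelief (κ t i (hist σ ω.2 t i)) (coeffs G c v t i) ω.2) ∧
      SolvesSystem β δ (coeffs G c v t) (v t) ∧
      (∀ w : V → V → ℝ, SolvesSystem β δ (coeffs G c v t) w →
        IsStageEquilibrium c β δ σ t (κ t) (fun i => linearStrategy (κ t i) (w i))) := by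
  intro t
  have hH := ae_hist_eq_linHist hσ hκ hlin t
  have hB : ∀ i, ∀ᵐ ω ∂(stateSignalLaw c),
      IsGaussianBelief (κ t i (hist σ ω.2 t i)) (coeffs G c v t i) ω.2 :=
    fun i => ae_isGaussianBelief hσ (hκ t i) (hH i)
  have hG : ∀ i, ∀ᵐ h ∂(histLaw c σ t i), IsGaussian (κ t i h) :=
    fun i => ae_isGaussian_posterior (hκ t i) (hH i)
  have hmeas : ∀ i, Measurable fun ω : ℝ × (V → ℝ) => hist σ ω.2 t i :=
    fun i => (measurable_hist hσ t i).comp measurable_snd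
  have hlinω : ∀ i, ∀ᵐ ω ∂(stateSignalLaw c),
      σ t i (hist σ ω.2 t i) = (v t i ᵥ* (coeffs G c v t i).L) ⬝ᵥ ω.2 := fun i => by
    filter_upwards [ae_of_ae_map (hmeas i).aemeasurable (hlin t i), hB i] with ω h1 h2
    rw [h1, linearStrategy_eq_of_isGaussianBelief h2]
  refine ⟨hB, ?_, fun w hw => ?_⟩
  · have hfoc := (isStageEquilibrium_iff β δ hσ (hκ t) hG hlinω).1 (heq t)
    rw [solvesSystem_iff]
    intro i
    -- Both sides are coefficients of linear functionals that agree at almost every signal vector.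
    rw [← sub_eq_zero]
    refine eq_zero_of_ae_dotProduct_eq_zero hc ?_
    filter_upwards [ae_of_ae_map (hmeas i).aemeasurable (hfoc i), hlinω i, hB i] with ω h1 h2 h3
    rw [sub_dotProduct, ← h2, h1, bestResponse_eq_of_isGaussianBelief h3, sub_self]
  · rw [solvesSystem_iff] at hw
    refine (isStageEquilibrium_iff (b := fun j => w j ᵥ* (coeffs G c v t j).L) β δ hσ (hκ t) hG
      fun j => ?_).2 fun i => ?_
    · filter_upwards [hB j] with ω h2
      exact linearStrategy_eq_of_isGaussianBelief h2 _
    · have := (hκ t i).isMarkov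
      have hx := measurable_integral_signal (κ t i)
      have hθ : Measurable fun h => ∫ ω, ω.1 ∂(κ t i h) :=
        (StronglyMeasurable.integral_kernel (κ := κ t i) (f := fun ω : ℝ × (V → ℝ) => ω.1)
          measurable_fst.stronglyMeasurable).measurable
      -- Measurability in the history lets the identity pass from realizations to histories.
      rw [histLaw, ae_map_iff (hmeas i).aemeasurable
        (measurableSet_eq_fun (by unfold linearStrategy; fun_prop)
          (by unfold bestResponse dotProduct; fun_prop))]
      filter_upwards [hB i] with ω h2
      rw [linearStrategy_eq_of_isGaussianBelief h2, bestResponse_eq_of_isGaussianBelief h2, hw i]
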